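/- Consider the asynchronous shared memory model with one writer and $r$ readers, each a deterministic automaton (with arbitrarily many local states, kept from one operation to the next), which communicate only through $n$ physical registers. Each physical register is an atomic single-writer register with $b \ge 2$ possible values: every read or write of it is a single indivisible step, and only one process ever writes to it. The processes implement a single-writer register with $m$ possible values and a given initial value: the writer may invoke $\mathrm{write}(v)$ for any of the $m$ values $v$, and each reader may invoke $\mathrm{read}$. Suppose that the implementation is - *regular*: in every execution, each completed read returns the value of a write operation concurrent with it, or the value of the last write operation completed before the read begins (the initial value, if no write is completed before the read begins); - *obstruction-free*: if, at the end of any finite execution, a process with an operation in progress runs in isolation, then this operation terminates after finitely many steps; and that at least one reader is *invisible*, i.e. it never writes to a physical register in any execution. Then the implementation uses at least $$n \;\ge\; \left\lceil \frac{m-1}{b-1} \right\rceil$$ physical registers. -/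

import Mathlib

universe u

namespace RegisterSim

/-- The processes: one writer and `r` readers of the implemented register. -/
inductive Proc (r : ℕ) : Type
  | writer : Proc r
  | reader (q : Fin r) : Proc r
  deriving DecidableEq

/-- The argument of a high-level operation: the writer invokes `write x` with `x : Fin m`,
a reader invokes `read` (no argument). -/
abbrev Proc.Input (m : ℕ) {r : ℕ} : Proc r → Type
  | .writer => Fin m
  | .reader _ => Unit

/-- The response of a high-level operation: a write is acknowledged, a read returns a value. -/
abbrev Proc.Output (m : ℕ) {r : ℕ} : Proc r → Type
  | .writer => Unit
  | .reader _ => Fin m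

/-- What a process with an operation in progress does next, as determined by its local state:
read physical register `R` and move to the local state `k a`, where `a` is the value obtained;
write `a` to physical register `R` and move to the local state `s`;
or complete its operation with response `y`, keeping the local state `s`. -/
inductive Move (n b : ℕ) (σ : Type u) (ρ : Type) : Type u
  | read (R : Fin n) (k : Fin b → σ) : Move n b σ ρ
  | write (R : Fin n) (a : Fin b) (s : σ) : Move n b σ ρ
  | ret (y : ρ) (s : σ) : Move n b σ ρ

/-- An algorithm in the asynchronous shared memory model for simulating an `m`-valued register
with one writer and `r` readers on top of `n` physical `b`-valued registers.  Every process is a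
deterministic automaton with an arbitrary (possibly infinite) set of local states, which
persist from one operation to the next.  No correctness requirement is built in. -/
structure Algorithm (m n b r : ℕ) : Type (u + 1) where
  /-- initial value of the implemented register -/
  initVal : Fin m
  /-- initial values of the physical registers -/
  initReg : Fin n → Fin b
  /-- local states -/
  State : Proc r → Type u
  /-- initial local states -/
  initState : (p : Proc r) → State p
  /-- local state after the invocation of an operation -/
  invoke : (p : Proc r) → p.Input m → State p → State p
  /-- next move of a process that has an operation in progress -/
  next : (p : Proc r) → State p → Move n b (State p) (p.Output m)

/-- The events: invocation of an operation, read step, write step, response of an operation.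
Since the physical registers are atomic, a read or write of one is a single step. -/
inductive Event (m n b r : ℕ) : Type
  | invoke (p : Proc r) (x : p.Input m) : Event m n b r
  | read (p : Proc r) (R : Fin n) (a : Fin b) : Event m n b r
  | write (p : Proc r) (R : Fin n) (a : Fin b) : Event m n b r
  | ret (p : Proc r) (y : p.Output m) : Event m n b r

namespace Algorithm

variable {m n b r : ℕ}

/-- A configuration: the contents of all physical registers and the state of all processes,
where `busy p` records whether `p` has an operation in progress. -/
structure Config (A : Algorithm.{u} m n b r) : Type u where
  reg : Fin n → Fin b
  loc : (p : Proc r) → A.State p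
  busy : Proc r → Bool

/-- The initial configuration. -/
def initConfig (A : Algorithm.{u} m n b r) : A.Config where
  reg := A.initReg
  loc := A.initState
  busy := fun _ => false

/-- `A.Step C e C'`: event `e` can occur in configuration `C` and leads to `C'`. -/
inductive Step (A : Algorithm.{u} m n b r) : A.Config → Event m n b r → A.Config → Prop
  | invoke (C : A.Config) (p : Proc r) (x : p.Input m) (h : C.busy p = false) :
      Step A C (.invoke p x)
        ⟨C.reg, Function.update C.loc p (A.invoke p x (C.loc p)), Function.update C.busy p true⟩
  | read (C : A.Config) (p : Proc r) (R : Fin n) (k : Fin b → A.State p)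
      (h : C.busy p = true) (hnext : A.next p (C.loc p) = .read R k) :
      Step A C (.read p R (C.reg R))
        ⟨C.reg, Function.update C.loc p (k (C.reg R)), C.busy⟩
  | write (C : A.Config) (p : Proc r) (R : Fin n) (a : Fin b) (s : A.State p)
      (h : C.busy p = true) (hnext : A.next p (C.loc p) = .write R a s) :
      Step A C (.write p R a)
        ⟨Function.update C.reg R a, Function.update C.loc p s, C.busy⟩
  | ret (C : A.Config) (p : Proc r) (y : p.Output m) (s : A.State p)
      (h : C.busy p = true) (hnext : A.next p (C.loc p) = .ret y s) :
      Step A C (.ret p y)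
        ⟨C.reg, Function.update C.loc p s, Function.update C.busy p false⟩

/-- `A.Exec es C`: there is a finite execution of `A`, starting in the initial configuration, with
sequence of events `es` and final configuration `C`.  Every process may invoke operations
(the writer with any values) and take steps at arbitrary times; a process may also stop forever. -/
inductive Exec (A : Algorithm.{u} m n b r) : List (Event m n b r) → A.Config → Prop
  | nil : Exec A [] A.initConfig
  | snoc {es : List (Event m n b r)} {C : A.Config} {e : Event m n b r} {C' : A.Config} :
      Exec A es C → A.Step C e C' → Exec A (es ++ [e]) C'

/-- `SoloStep p C C'`: `C'` results from `C` by one step of `p` (reading or writing a physical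
register, or completing) of the operation that `p` has in progress. -/
def SoloStep (A : Algorithm.{u} m n b r) (p : Proc r) (C C' : A.Config) : Prop :=
  (∃ R a, A.Step C (.read p R a) C') ∨ (∃ R a, A.Step C (.write p R a) C') ∨
    (∃ y, A.Step C (.ret p y) C')

/-- Obstruction-freedom: whenever a process `p` with an operation in progress is run alone from the
end of any execution, its operation completes after finitely many steps.  (Steps of `p` are
deterministic, so there is only one solo run of the operation.) -/
def ObstructionFree (A : Algorithm.{u} m n b r) : Prop :=
  ∀ es C, A.Exec es C → ∀ p, C.busy p = true →
    ∃ C', Relation.ReflTransGen (A.SoloStep p) C C' ∧ C'.busy p = false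

/-- The physical registers are single-writer: each has an owner, the only process that ever
writes to it. -/
def SingleWriter (A : Algorithm.{u} m n b r) : Prop :=
  ∃ owner : Fin n → Proc r, ∀ es C, A.Exec es C →
    ∀ p R a, Event.write p R a ∈ es → p = owner R

/-- Reader `q` is invisible: it never writes to a physical register, in any execution. -/
def Invisible (A : Algorithm.{u} m n b r) (q : Fin r) : Prop :=
  ∀ es C, A.Exec es C → ∀ R a, Event.write (.reader q) R a ∉ es

end Algorithm

section Histories

variable {m n b r : ℕ}

/-- In `es`, an operation `read` by reader `q` is invoked at position `i` and it returns `v`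
at position `j`. -/
def IsRead (es : List (Event m n b r)) (q : Fin r) (v : Fin m) (i j : ℕ) : Prop :=
  i < j ∧ es[i]? = some (.invoke (.reader q) ()) ∧ es[j]? = some (.ret (.reader q) v) ∧
    ∀ k, i < k → k < j → ∀ v' : Fin m, es[k]? ≠ some (.ret (.reader q) v')

/-- In `es`, an operation `write v` is invoked at position `k`. -/
def IsWrite (es : List (Event m n b r)) (v : Fin m) (k : ℕ) : Prop :=
  es[k]? = some (.invoke .writer v)

/-- The write invoked at position `k` is acknowledged before position `i`.  (The writer performs
its operations one after the other, so the first acknowledgement after `k` is that of this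
write.) -/
def WriteDoneBefore (es : List (Event m n b r)) (k i : ℕ) : Prop :=
  ∃ l, k < l ∧ l < i ∧ es[l]? = some (.ret .writer ())

/-- `v` may be returned under regular semantics by a read with invocation at position `i` and
response at position `j`: it is written by a write concurrent with the read (one that is invoked
before `j` and not completed before `i`), or by the last write completed before `i`, or no write is
completed before `i` and `v` is the initial value. -/
def RegularValue (v₀ : Fin m) (es : List (Event m n b r)) (v : Fin m) (i j : ℕ) : Prop :=
  (∃ k, IsWrite es v k ∧ k < j ∧ ¬ WriteDoneBefore es k i) ∨
  (∃ k, IsWrite es v k ∧ WriteDoneBefore es k i ∧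
    ∀ v' k', IsWrite es v' k' → WriteDoneBefore es k' i → k' ≤ k) ∨
  (v = v₀ ∧ ∀ v' k', IsWrite es v' k' → ¬ WriteDoneBefore es k' i)

end Histories

/-- `A` implements a regular register: in every execution, every completed read returns a value
allowed by regular semantics. -/
def Algorithm.Regular {m n b r : ℕ} (A : Algorithm.{u} m n b r) : Prop :=
  ∀ es C, A.Exec es C → ∀ q v i j, IsRead es q v i j → RegularValue A.initVal es v i j

end RegisterSim

/-! Count, over all registers, the values a register can still take while the writer invokes only
values of a set `S`. These sets only shrink along a run, so some run makes them stable: nothing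
attainable is ever lost again (`exists_stable`).

Dropping `v` from `S` and stabilizing again lowers the total strictly. Otherwise the contents `c`
present after a complete `write v` remain attainable, register by register, while only the remaining
values are written. An invisible reader alone on `c` returns `v`. The writer cannot notice this
reader, so it can bring `R` to `c R` just before each read of `R` (`Sees.exists_run`). The reader
again returns `v`, although neither the last completed write nor any concurrent one has value `v`,
against regularity.

Each register has at least one value, so the total is at least `n` for a singleton and, by induction
(`Regular.card_le_sum_card_vals`), at least `n + m - 1` for all `m` values. It is at most `n * b`.
-/

namespace RegisterSim

variable {m n b r : ℕ}

/-! ### Histories and regularity -/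

/-- Steps of the writer, where only values in `S` may be invoked. -/
inductive WriterEvent (S : Set (Fin m)) : Event m n b r → Prop
  | invoke (x : Fin m) (hx : x ∈ S) : WriterEvent S (.invoke .writer x)
  | read (R : Fin n) (a : Fin b) : WriterEvent S (.read .writer R a)
  | write (R : Fin n) (a : Fin b) : WriterEvent S (.write .writer R a)
  | ret : WriterEvent S (.ret .writer ())

theorem WriterEvent.mono {S T : Set (Fin m)} (h : S ⊆ T) {e : Event m n b r}
    (he : WriterEvent S e) : WriterEvent T e := by
  cases he with
  | invoke x hx => exact .invoke x (h hx)
  | read R a => exact .read R a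
  | write R a => exact .write R a
  | ret => exact .ret

/-- Steps of the writer invoking only values in `S`, and reading steps of reader `q`. -/
def SharedEvent (S : Set (Fin m)) (q : Fin r) (e : Event m n b r) : Prop :=
  WriterEvent S e ∨ ∃ R a, e = .read (.reader q) R a

/-- The history `es` ends with a complete operation `write w`, possibly after other operations. -/
def EndsWithWrite (w : Fin m) (es : List (Event m n b r)) : Prop :=
  ∃ pre mid, es = pre ++ .invoke .writer w :: (mid ++ [.ret .writer ()]) ∧
    ∀ e ∈ mid, WriterEvent ∅ e

theorem EndsWithWrite.append_left {w : Fin m} {es : List (Event m n b r)}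
    (h : EndsWithWrite w es) (es' : List (Event m n b r)) : EndsWithWrite w (es' ++ es) := by
  obtain ⟨pre, mid, rfl, hmid⟩ := h
  exact ⟨es' ++ pre, mid, by simp, hmid⟩

/-- In a history that ends with a complete `write w`, this is the last write invoked, and all
writes are completed. -/
theorem EndsWithWrite.last {w : Fin m} {es : List (Event m n b r)} (h : EndsWithWrite w es)
    (l : List (Event m n b r)) :
    ∃ k < es.length, IsWrite (es ++ l) w k ∧ WriteDoneBefore (es ++ l) k es.length ∧
      ∀ v' k', IsWrite (es ++ l) v' k' → k' < es.length →
        WriteDoneBefore (es ++ l) k' es.length ∧ k' ≤ k := by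
  obtain ⟨pre, mid, rfl, hmid⟩ := h
  have hret : (pre ++ Event.invoke .writer w :: (mid ++ [Event.ret .writer ()]) ++ l)[
      pre.length + 1 + mid.length]? = some (.ret .writer ()) := by
    rw [List.getElem?_append_left (by simp; omega), List.getElem?_append_right (by omega),
      show pre.length + 1 + mid.length - pre.length = mid.length + 1 by omega]
    simp
  have hbefore : ∀ v' k',
      IsWrite (pre ++ Event.invoke .writer w :: (mid ++ [Event.ret .writer ()]) ++ l) v' k' →
      k' < (pre ++ Event.invoke .writer w :: (mid ++ [Event.ret .writer ()])).length →
      k' ≤ pre.length := by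
    intro v' k' hw hk
    -- A later position of the prefix lies in `mid` or is the final acknowledgement; neither is an
    -- invocation.
    by_contra! hlt
    obtain ⟨d, rfl⟩ : ∃ d, k' = pre.length + (d + 1) := ⟨k' - pre.length - 1, by omega⟩
    unfold IsWrite at hw
    rw [List.getElem?_append_left hk, List.getElem?_append_right (by omega)] at hw
    simp only [Nat.add_sub_cancel_left, List.getElem?_cons_succ] at hw
    rcases List.mem_append.1 (List.mem_of_getElem? hw) with h | h
    · cases hmid _ h with
      | invoke x hx => exact hx
    · simp at h
  have hdone : ∀ k', k' ≤ pre.length →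
      WriteDoneBefore (pre ++ Event.invoke .writer w :: (mid ++ [Event.ret .writer ()]) ++ l) k'
        (pre ++ Event.invoke .writer w :: (mid ++ [Event.ret .writer ()])).length :=
    fun k' hk => ⟨pre.length + 1 + mid.length, by omega, by simp; omega, hret⟩
  refine ⟨pre.length, by simp, ?_, hdone _ le_rfl, fun v' k' hw hk => ?_⟩
  · simp [IsWrite]
  · exact ⟨hdone _ (hbefore v' k' hw hk), hbefore v' k' hw hk⟩

/-- A regular read invoked just after a complete `write w` returns `w` or a value written by a
concurrent write. -/
theorem EndsWithWrite.regularValue {w v₀ y : Fin m} {q : Fin r} {S : Set (Fin m)}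
    {es mid : List (Event m n b r)} (h : EndsWithWrite w es)
    (hmid : ∀ e ∈ mid, SharedEvent S q e)
    (hy : RegularValue v₀ (es ++ .invoke (.reader q) () :: (mid ++ [.ret (.reader q) y])) y
      es.length (es.length + 1 + mid.length)) : y = w ∨ y ∈ S := by
  obtain ⟨k, hk, hkw, hkd, hlast⟩ := h.last (.invoke (.reader q) () :: (mid ++ [.ret (.reader q) y]))
  rcases hy with ⟨k', hw', hk', hnd⟩ | ⟨k', hw', hd, hmax⟩ | ⟨-, hnone⟩
  · right
    -- All writes invoked in `es` are complete when the read starts, so a concurrent one is invoked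
    -- in `mid`.
    have hge : es.length ≤ k' := by
      by_contra! hlt
      exact hnd (hlast _ _ hw' hlt).1
    obtain ⟨d, rfl⟩ := Nat.exists_eq_add_of_le hge
    unfold IsWrite at hw'
    rw [List.getElem?_append_right (by omega), Nat.add_sub_cancel_left] at hw'
    cases d with
    | zero => simp at hw'
    | succ d =>
      rw [List.getElem?_cons_succ] at hw'
      rcases List.mem_append.1 (List.mem_of_getElem? hw') with h | h
      · rcases hmid _ h with h | ⟨R, a, h⟩
        · cases h with
          | invoke x hx => exact hx
        · cases h
      · simp at h
  · left
    have hlt : k' < es.length := by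
      obtain ⟨l, h1, h2, -⟩ := hd
      omega
    have : k' = k := le_antisymm (hlast _ _ hw' hlt).2 (hmax _ _ hkw hkd)
    subst this
    have := hw'.symm.trans hkw
    simpa using this
  · exact absurd hkd (hnone _ _ hkw)

theorem isRead_append {q : Fin r} {S : Set (Fin m)} {y : Fin m} (es : List (Event m n b r))
    {mid : List (Event m n b r)} (hmid : ∀ e ∈ mid, SharedEvent S q e) :
    IsRead (es ++ .invoke (.reader q) () :: (mid ++ [.ret (.reader q) y])) q y
      es.length (es.length + 1 + mid.length) := by
  refine ⟨by omega, by simp, ?_, fun k h1 h2 v' hk => ?_⟩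
  · rw [List.getElem?_append_right (by omega),
      show es.length + 1 + mid.length - es.length = mid.length + 1 by omega]
    simp
  · obtain ⟨d, rfl⟩ : ∃ d, k = es.length + (d + 1) := ⟨k - es.length - 1, by omega⟩
    rw [List.getElem?_append_right (by omega), Nat.add_sub_cancel_left,
      List.getElem?_cons_succ, List.getElem?_append_left (by omega)] at hk
    rcases hmid _ (List.mem_of_getElem? hk) with h | ⟨R, a, h⟩
    · cases h
    · cases h

namespace Algorithm

variable {A : Algorithm.{u} m n b r}

/-! ### Execution fragments and the writer's blindness to an invisible reader -/

/-- A finite execution fragment from one configuration to another, all of whose events satisfy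
`P`. -/
inductive Run (A : Algorithm.{u} m n b r) (P : Event m n b r → Prop) :
    A.Config → List (Event m n b r) → A.Config → Prop
  | nil (C : A.Config) : Run A P C [] C
  | cons {C C' C'' : A.Config} {e : Event m n b r} {es : List (Event m n b r)} :
      P e → A.Step C e C' → Run A P C' es C'' → Run A P C (e :: es) C''

namespace Run

variable {P Q : Event m n b r → Prop} {C C' C'' : A.Config} {es es' : List (Event m n b r)}

theorem trans (h : A.Run P C es C') (h' : A.Run P C' es' C'') : A.Run P C (es ++ es') C'' := by
  induction h with
  | nil => exact h'
  | cons he hs _ ih => exact .cons he hs (ih h')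

theorem mono (hPQ : ∀ e, P e → Q e) (h : A.Run P C es C') : A.Run Q C es C' := by
  induction h with
  | nil => exact .nil _
  | cons he hs _ ih => exact .cons (hPQ _ he) hs ih

theorem forall_mem (h : A.Run P C es C') : ∀ e ∈ es, P e := by
  induction h with
  | nil => simp
  | cons he _ _ ih => simpa using ⟨he, ih⟩

theorem exec (h : A.Run P C es' C') (hC : A.Exec es C) : A.Exec (es ++ es') C' := by
  induction h generalizing es with
  | nil => simpa using hC
  | cons _ hs _ ih => simpa using ih (hC.snoc hs)

end Run

/-- `C` with the state of reader `q` replaced. -/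
def withReader (C : A.Config) (q : Fin r) (s : A.State (.reader q)) (β : Bool) : A.Config :=
  ⟨C.reg, Function.update C.loc (.reader q) s, Function.update C.busy (.reader q) β⟩

/-- Steps of the writer do not depend on the state of a reader. -/
theorem Step.withReader {S : Set (Fin m)} {C C' : A.Config} {e : Event m n b r}
    (h : A.Step C e C') (he : WriterEvent S e) (q : Fin r) (s : A.State (.reader q)) (β : Bool) :
    A.Step (withReader C q s β) e (withReader C' q s β) := by
  have hne : (Proc.writer : Proc r) ≠ .reader q := by simp
  have hloc : (Algorithm.withReader C q s β).loc .writer = C.loc .writer :=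
    Function.update_of_ne hne s _
  have hbusy : (Algorithm.withReader C q s β).busy .writer = C.busy .writer :=
    Function.update_of_ne hne β _
  cases he with
  | invoke x hx =>
    cases h with
    | invoke _ _ h =>
      have := Step.invoke (A := A) (Algorithm.withReader C q s β) .writer x (hbusy.trans h)
      rw [hloc] at this
      simpa only [Algorithm.withReader, Function.update_comm hne] using this
  | read R a =>
    cases h with
    | read _ _ k h hnext =>
      have := Step.read (A := A) (Algorithm.withReader C q s β) .writer R k (hbusy.trans h)
        (by rw [hloc]; exact hnext)
      simpa only [Algorithm.withReader, Function.update_comm hne] using this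
  | write R a =>
    cases h with
    | write _ _ _ t h hnext =>
      have := Step.write (A := A) (Algorithm.withReader C q s β) .writer R a t (hbusy.trans h)
        (by rw [hloc]; exact hnext)
      simpa only [Algorithm.withReader, Function.update_comm hne] using this
  | ret =>
    cases h with
    | ret _ _ t h hnext =>
      have := Step.ret (A := A) (Algorithm.withReader C q s β) .writer () t (hbusy.trans h)
        (by rw [hloc]; exact hnext)
      simpa only [Algorithm.withReader, Function.update_comm hne] using this

theorem Run.withReader {S : Set (Fin m)} {C C' : A.Config} {es : List (Event m n b r)}
    (h : A.Run (WriterEvent S) C es C') (q : Fin r) (s : A.State (.reader q)) (β : Bool) :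
    A.Run (WriterEvent S) (withReader C q s β) es (withReader C' q s β) := by
  induction h with
  | nil => exact .nil _
  | cons he hs _ ih => exact .cons he (hs.withReader he q s β) ih

/-- Steps of the writer do not change the state of a reader. -/
theorem Run.reader_eq {S : Set (Fin m)} {C C' : A.Config} {es : List (Event m n b r)}
    (h : A.Run (WriterEvent S) C es C') (q : Fin r) :
    C'.loc (.reader q) = C.loc (.reader q) ∧ C'.busy (.reader q) = C.busy (.reader q) := by
  induction h with
  | nil => exact ⟨rfl, rfl⟩
  | cons he hs _ ih =>
    rw [ih.1, ih.2]
    cases he <;> cases hs <;> simp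

/-! ### What a reader sees -/

/-- Reader `q`, starting a step in local state `s` and always obtaining `c R` from register `R`,
completes its operation with response `y`. -/
inductive Sees (A : Algorithm.{u} m n b r) (q : Fin r) (c : Fin n → Fin b) :
    A.State (.reader q) → Fin m → Prop
  | ret {s t : A.State (.reader q)} {y : Fin m} (h : A.next (.reader q) s = .ret y t) :
      Sees A q c s y
  | read {s : A.State (.reader q)} {R : Fin n} {k : Fin b → A.State (.reader q)} {y : Fin m}
      (h : A.next (.reader q) s = .read R k) (hk : Sees A q c (k (c R)) y) : Sees A q c s y

/-- In a solo run of an invisible reader the registers never change, so every read obtains the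
contents present at the start. -/
theorem Invisible.exists_sees {q : Fin r} (hinv : A.Invisible q) {C C' : A.Config}
    (hrun : Relation.ReflTransGen (A.SoloStep (.reader q)) C C')
    (hC' : C'.busy (.reader q) = false) :
    ∀ {es : List (Event m n b r)}, A.Exec es C → C.busy (.reader q) = true →
      ∃ y, A.Sees q C.reg (C.loc (.reader q)) y := by
  induction hrun using Relation.ReflTransGen.head_induction_on with
  | refl => intro es _ h; simp [hC'] at h
  | head hs _ ih =>
    intro es hex hbusy
    rcases hs with ⟨R, a, hs⟩ | ⟨R, a, hs⟩ | ⟨y, hs⟩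
    · have hex' := hex.snoc hs
      cases hs with
      | read _ _ k h hnext =>
        obtain ⟨y, hy⟩ := ih hex' h
        exact ⟨y, .read hnext (by simpa using hy)⟩
    · exact absurd (by simp) (hinv _ _ (hex.snoc hs) R a)
    · cases hs with
      | ret _ _ t h hnext => exact ⟨y, .ret hnext⟩

/-- If the writer can always bring each register `R` to the contents `c R`, then a reader that
behaves as on constant register contents `c` can be interleaved with the writer. -/
theorem Sees.exists_run {q : Fin r} {c : Fin n → Fin b} {s : A.State (.reader q)} {y : Fin m}
    (h : A.Sees q c s y) {S : Set (Fin m)} {G : Set A.Config}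
    (hG : ∀ C ∈ G, ∀ R, ∃ es, ∃ C' ∈ G, A.Run (WriterEvent S) C es C' ∧ C'.reg R = c R) :
    ∀ C ∈ G, ∃ es C₁ C₂, A.Run (SharedEvent S q) (withReader C q s true) es C₁ ∧
      A.Step C₁ (.ret (.reader q) y) C₂ := by
  induction h with
  | @ret s t y h =>
    intro C _
    exact ⟨[], _, _, .nil _, .ret _ _ y t (by simp [withReader]) (by simpa [withReader] using h)⟩
  | @read s R k y h _ ih =>
    intro C hC
    -- Only the register about to be read must be right: the contents need never equal `c` all at
    -- once.
    obtain ⟨es, C', hC', hrun, hreg⟩ := hG C hC R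
    obtain ⟨es', C₁, C₂, hrun', hret⟩ := ih C' hC'
    have hstep := Step.read (A := A) (withReader C' q s true) (.reader q) R k
      (by simp [withReader]) (by simpa [withReader] using h)
    refine ⟨es ++ _ :: es', C₁, C₂, ((hrun.withReader q s true).mono (Q := SharedEvent S q)
      fun e he => Or.inl he).trans (.cons (Or.inr ⟨_, _, rfl⟩) hstep ?_), hret⟩
    simpa [withReader, hreg] using hrun'

/-! ### First reads after writer-only executions -/

/-- The configurations that the writer can reach while all readers are idle, with their
histories. -/
abbrev WriterReach (A : Algorithm.{u} m n b r) (es : List (Event m n b r)) (C : A.Config) : Prop :=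
  A.Run (WriterEvent Set.univ) A.initConfig es C

theorem WriterReach.exec {es : List (Event m n b r)} {C : A.Config} (h : A.WriterReach es C) :
    A.Exec es C := by
  simpa using Run.exec h .nil

theorem WriterReach.trans {S : Set (Fin m)} {es es' : List (Event m n b r)} {C C' : A.Config}
    (h : A.WriterReach es C) (h' : A.Run (WriterEvent S) C es' C') :
    A.WriterReach (es ++ es') C' :=
  Run.trans h (h'.mono fun _ => WriterEvent.mono (Set.subset_univ S))

/-- When a reader is idle so far, it can invoke its first operation. -/
theorem WriterReach.step_invoke {es : List (Event m n b r)} {C : A.Config}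
    (h : A.WriterReach es C) (q : Fin r) :
    A.Step C (.invoke (.reader q) ())
      (withReader C q (A.invoke (.reader q) () (A.initState (.reader q))) true) := by
  -- The reader is still in its initial local state, so its first read starts identically after
  -- every writer-only history.
  have := Step.invoke (A := A) C (.reader q) () (Run.reader_eq h q).2
  rwa [(Run.reader_eq h q).1] at this

/-- A first read that sees contents `c` which the writer, invoking only values in `S`, can always
produce register by register, returns the last value written before it or a value in `S`. -/
theorem Regular.eq_or_mem {q : Fin r} (hreg : A.Regular) {es : List (Event m n b r)}
    {C : A.Config} (hC : A.WriterReach es C) {w : Fin m} (hw : EndsWithWrite w es)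
    {c : Fin n → Fin b} {y : Fin m}
    (hy : A.Sees q c (A.invoke (.reader q) () (A.initState (.reader q))) y)
    {S : Set (Fin m)} {G : Set A.Config} (hCG : C ∈ G)
    (hG : ∀ C ∈ G, ∀ R, ∃ es, ∃ C' ∈ G, A.Run (WriterEvent S) C es C' ∧ C'.reg R = c R) :
    y = w ∨ y ∈ S := by
  obtain ⟨mid, C₁, C₂, hrun, hret⟩ := hy.exists_run hG C hCG
  have hex := (hrun.exec (hC.exec.snoc (hC.step_invoke q))).snoc hret
  rw [show es ++ [.invoke (.reader q) ()] ++ mid ++ [.ret (.reader q) y] =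
    es ++ .invoke (.reader q) () :: (mid ++ [.ret (.reader q) y]) by simp] at hex
  exact hw.regularValue hrun.forall_mem
    (hreg _ _ hex q y _ _ (isRead_append es hrun.forall_mem))

/-- A first read running alone after a complete `write w` returns `w`. -/
theorem Regular.sees_of_endsWithWrite {q : Fin r} (hreg : A.Regular) (hof : A.ObstructionFree)
    (hinv : A.Invisible q) {es : List (Event m n b r)} {C : A.Config}
    (hC : A.WriterReach es C) {w : Fin m} (hw : EndsWithWrite w es) :
    A.Sees q C.reg (A.invoke (.reader q) () (A.initState (.reader q))) w := by
  have hex := hC.exec.snoc (hC.step_invoke q)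
  have hbusy : (withReader C q (A.invoke (.reader q) () (A.initState (.reader q))) true).busy
      (.reader q) = true := by simp [withReader]
  obtain ⟨C', hrun, hC'⟩ := hof _ _ hex _ hbusy
  obtain ⟨y, hy⟩ := hinv.exists_sees hrun hC' hex hbusy
  simp only [withReader, Function.update_self] at hy
  -- The registers already hold the contents seen, so the writer has nothing to do during the read.
  have : y = w ∨ y ∈ (∅ : Set (Fin m)) := by
    refine hreg.eq_or_mem hC hw hy (G := {C}) rfl ?_
    intro C' hC' R
    obtain rfl : C' = C := hC'
    exact ⟨[], C', rfl, .nil _, rfl⟩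
  rcases this with rfl | h
  · exact hy
  · exact h.elim

/-! ### Completing writes -/

/-- A pending write runs to completion. -/
theorem exists_run_ret {C C' : A.Config}
    (hrun : Relation.ReflTransGen (A.SoloStep .writer) C C') (hC' : C'.busy .writer = false)
    (hC : C.busy .writer = true) :
    ∃ mid C₁, A.Run (WriterEvent ∅) C (mid ++ [.ret .writer ()]) C₁ ∧
      C₁.busy .writer = false := by
  induction hrun using Relation.ReflTransGen.head_induction_on with
  | refl => simp [hC'] at hC
  | head hs _ ih =>
    rcases hs with ⟨R, a, hs⟩ | ⟨R, a, hs⟩ | ⟨y, hs⟩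
    · obtain ⟨mid, C₁, h, h'⟩ := ih (by cases hs; assumption)
      exact ⟨_ :: mid, C₁, .cons (.read R a) hs h, h'⟩
    · obtain ⟨mid, C₁, h, h'⟩ := ih (by cases hs; assumption)
      exact ⟨_ :: mid, C₁, .cons (.write R a) hs h, h'⟩
    · refine ⟨[], _, .cons .ret hs (.nil _), ?_⟩
      cases hs
      simp

/-- The writer can complete its pending operation, if any, and then perform `write w`. -/
theorem ObstructionFree.exists_write (hof : A.ObstructionFree) {es : List (Event m n b r)}
    {C : A.Config} (hC : A.WriterReach es C) {S : Set (Fin m)} {w : Fin m} (hw : w ∈ S) :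
    ∃ es' C', A.Run (WriterEvent S) C es' C' ∧ EndsWithWrite w es' := by
  have hempty : ∀ e : Event m n b r, WriterEvent ∅ e → WriterEvent S e :=
    fun _ => WriterEvent.mono (Set.empty_subset S)
  obtain ⟨pre, C₁, hpre, hidle⟩ : ∃ pre C₁, A.Run (WriterEvent S) C pre C₁ ∧
      C₁.busy .writer = false := by
    cases hb : C.busy .writer with
    | false => exact ⟨[], C, .nil _, hb⟩
    | true =>
      obtain ⟨C', hrun, hC'⟩ := hof _ _ hC.exec _ hb
      obtain ⟨mid, C₁, h, h'⟩ := exists_run_ret hrun hC' hb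
      exact ⟨_, C₁, h.mono hempty, h'⟩
  have hstep := Step.invoke (A := A) C₁ .writer w hidle
  have hinvoke := hpre.trans (.cons (.invoke w hw) hstep (.nil _))
  obtain ⟨C', hrun, hC'⟩ := hof _ _ (hC.trans hinvoke).exec .writer (by simp)
  obtain ⟨mid, C₂, h, -⟩ := exists_run_ret hrun hC' (by simp)
  refine ⟨_, C₂, hinvoke.trans (h.mono hempty), pre, mid, by simp, fun e he => ?_⟩
  exact h.forall_mem e (by simp [he])

/-! ### Counting attainable register values -/

open Classical in
/-- The values that register `R` can take while the writer runs from `C`, invoking only values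
in `S`. -/
noncomputable def vals (S : Set (Fin m)) (C : A.Config) (R : Fin n) : Finset (Fin b) :=
  Finset.univ.filter fun a => ∃ es C', A.Run (WriterEvent S) C es C' ∧ C'.reg R = a

theorem mem_vals {S : Set (Fin m)} {C : A.Config} {R : Fin n} {a : Fin b} :
    a ∈ vals S C R ↔ ∃ es C', A.Run (WriterEvent S) C es C' ∧ C'.reg R = a := by
  simp [vals]

theorem Run.vals_subset {S T : Set (Fin m)} (hST : T ⊆ S) {C C' : A.Config}
    {es : List (Event m n b r)} (h : A.Run (WriterEvent S) C es C') (R : Fin n) :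
    vals T C' R ⊆ vals S C R := by
  intro a ha
  obtain ⟨es', C'', h', rfl⟩ := mem_vals.1 ha
  exact mem_vals.2 ⟨_, C'', h.trans (h'.mono fun _ => WriterEvent.mono hST), rfl⟩

/-- No value of a register gets lost while the writer runs from `C`, invoking only values in
`S`. -/
def Stable (S : Set (Fin m)) (C : A.Config) : Prop :=
  ∀ es C', A.Run (WriterEvent S) C es C' → ∀ R, vals S C R ⊆ vals S C' R

theorem Stable.of_run {S : Set (Fin m)} {C C' : A.Config} {es : List (Event m n b r)}
    (hC : Stable S C) (h : A.Run (WriterEvent S) C es C') : Stable S C' :=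
  fun _ _ h' R => (h.vals_subset subset_rfl R).trans (hC _ _ (h.trans h') R)

/-- Each failure of stability removes a value from some register for good, so the total number of
attainable values decreases; this can happen only finitely often. -/
theorem exists_stable (S : Set (Fin m)) (C : A.Config) :
    ∃ es C', A.Run (WriterEvent S) C es C' ∧ Stable S C' := by
  induction hN : ∑ R, (vals S C R).card using Nat.strong_induction_on generalizing C with
  | _ N ih =>
    by_cases hC : Stable S C
    · exact ⟨[], C, .nil _, hC⟩
    · unfold Stable at hC
      push Not at hC
      obtain ⟨es, C', hrun, R, hR⟩ := hC
      have hlt : ∑ R, (vals S C' R).card < N := by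
        rw [← hN]
        refine Finset.sum_lt_sum
          (fun R _ => Finset.card_le_card (hrun.vals_subset subset_rfl R)) ⟨R, by simp, ?_⟩
        exact Finset.card_lt_card ⟨hrun.vals_subset subset_rfl R, hR⟩
      obtain ⟨es', C'', hrun', hst⟩ := ih _ hlt C' rfl
      exact ⟨_, C'', hrun.trans hrun', hst⟩

/-- Register values used while the writer keeps writing values in `S` number at least
`n + |S| - 1`, counted register by register. -/
theorem Regular.card_le_sum_card_vals {q : Fin r} (hreg : A.Regular) (hof : A.ObstructionFree)
    (hinv : A.Invisible q) {S : Finset (Fin m)} (hS : S.Nonempty) :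
    ∀ {es : List (Event m n b r)} {C : A.Config}, A.WriterReach es C → Stable (S : Set (Fin m)) C →
      n + S.card ≤ ∑ R, (vals (S : Set (Fin m)) C R).card + 1 := by
  induction hS using Finset.Nonempty.cons_induction with
  | singleton v =>
    intro es C _ _
    have : ∑ R : Fin n, 1 ≤ ∑ R, (vals (({v} : Finset (Fin m)) : Set (Fin m)) C R).card :=
      Finset.sum_le_sum fun R _ => Finset.card_pos.2 ⟨C.reg R, mem_vals.2 ⟨[], C, .nil _, rfl⟩⟩
    simpa using this
  | cons v T hv hT ih =>
    intro es C hC _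
    have hTS : (T : Set (Fin m)) ⊆ (Finset.cons v T hv : Finset (Fin m)) := by
      intro x hx
      simpa using Or.inr hx
    -- Two branches leave `C`: this one completes `write v` and supplies the contents `C₁.reg` on
    -- which the reader returns `v`.
    obtain ⟨es₁, C₁, hrun₁, hw₁⟩ := hof.exists_write hC
      (S := ((Finset.cons v T hv : Finset (Fin m)) : Set (Fin m))) (w := v) (by simp)
    have hsees := hreg.sees_of_endsWithWrite hof hinv (hC.trans hrun₁) (hw₁.append_left es)
    obtain ⟨w, hwT⟩ := hT
    -- The other branch writes only values of `T`. Once stable, it performs `write w`, so that the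
    -- last completed write is not `write v`.
    obtain ⟨es₂, C₂, hrun₂, hst₂⟩ := exists_stable (T : Set (Fin m)) C
    have hC₂ := hC.trans hrun₂
    obtain ⟨es₃, C₃, hrun₃, hw₃⟩ := hof.exists_write hC₂ (S := (T : Set (Fin m))) (w := w) hwT
    have hst₃ := hst₂.of_run hrun₃
    have hC₃ := hC₂.trans hrun₃
    have hsub := ((hrun₂.trans hrun₃).mono fun _ => WriterEvent.mono hTS).vals_subset hTS
    have hlt : ∑ R, (vals (T : Set (Fin m)) C₃ R).card <
        ∑ R, (vals ((Finset.cons v T hv : Finset (Fin m)) : Set (Fin m)) C R).card := by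
      refine Finset.sum_lt_sum (fun R _ => Finset.card_le_card (hsub R)) ?_
      by_contra! hle
      -- If no register lost a value, all the sets agree, and every entry of `C₁.reg` is still
      -- attainable by writing in `T`.
      have hmem : ∀ R, C₁.reg R ∈ vals (T : Set (Fin m)) C₃ R := fun R => by
        rw [Finset.eq_of_subset_of_card_le (hsub R) (hle R (by simp))]
        exact mem_vals.2 ⟨_, C₁, hrun₁, rfl⟩
      have : v = w ∨ v ∈ (T : Set (Fin m)) := by
        refine hreg.eq_or_mem hC₃ (hw₃.append_left _) hsees
          -- Stability at `C₃` makes each entry attainable again from every configuration of `G`.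
          (G := {C' | ∃ es, A.Run (WriterEvent (T : Set (Fin m))) C₃ es C'}) ⟨[], .nil _⟩ ?_
        rintro C' ⟨es', hC'⟩ R
        obtain ⟨es'', C'', hrun, h⟩ := mem_vals.1 (hst₃ _ _ hC' R (hmem R))
        exact ⟨es'', C'', ⟨_, hC'.trans hrun⟩, hrun, h⟩
      rcases this with rfl | h
      · exact hv hwT
      · exact hv h
    have := ih hC₃ hst₃
    rw [Finset.card_cons]
    omega

/-- A regular obstruction-free implementation with an invisible reader satisfies
`m - 1 ≤ n (b - 1)`. -/
theorem Regular.card_le {q : Fin r} (hreg : A.Regular) (hof : A.ObstructionFree)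
    (hinv : A.Invisible q) : n + m ≤ n * b + 1 := by
  obtain ⟨es, C, hrun, hst⟩ := exists_stable Set.univ A.initConfig
  have h := hreg.card_le_sum_card_vals hof hinv (S := Finset.univ) ⟨A.initVal, by simp⟩
    (es := es) (C := C) hrun (by simpa using hst)
  have h' : ∑ R, (vals ((Finset.univ : Finset (Fin m)) : Set (Fin m)) C R).card ≤
      ∑ _R : Fin n, b :=
    Finset.sum_le_sum fun R _ => (Finset.card_le_univ _).trans_eq (Fintype.card_fin b)
  simp only [Finset.card_univ, Fintype.card_fin, Finset.sum_const, smul_eq_mul] at h h'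
  omega

end Algorithm

end RegisterSim

/-! ### The lower bound -/

theorem theorem1 {m n b r : ℕ} (hb : 2 ≤ b)
    (A : RegisterSim.Algorithm.{u} m n b r)
    (hsw : A.SingleWriter) (hreg : A.Regular) (hof : A.ObstructionFree)
    (hinv : ∃ q : Fin r, A.Invisible q) :
    ⌈((m : ℚ) - 1) / ((b : ℚ) - 1)⌉ ≤ (n : ℤ) := by
  obtain ⟨q, hq⟩ := hinv
  have h : (n : ℚ) + m ≤ n * b + 1 := by exact_mod_cast hreg.card_le hof hq
  have hb' : (2 : ℚ) ≤ b := by exact_mod_cast hb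
  rw [Int.ceil_le, div_le_iff₀ (by linarith)]
  push_cast
  linarith
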